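/- **Lemma 5 (Convergence to the sliding manifold).** Consider a power network of $n$ control areas on a connected simple undirected graph with $m$ lines, with incidence matrix $\mathcal B\in\mathbb R^{n\times m}$ for an arbitrary orientation of the lines, together with a controller state $\theta$ and an input integrator: $$\dot\eta=\mathcal B^{T}f,\qquad T_p\dot f=-f+K_p\big(P_t-P_d-\mathcal B\,\Gamma(V)\sin\eta\big),\qquad T_V\dot V=-(X_d-X_d')E(\eta)V+\overline E_f,$$ $$T_t\dot P_t=-P_t+P_g,\qquad T_g\dot P_g=-R^{-1}f-P_g+u,\qquad T_\theta\dot\theta=-\theta+P_t-A\mathcal L^{com}(\mathcal Q\theta+\mathcal R),\qquad \dot u=w .$$ Here $T_p,T_t,T_g,T_V,T_\theta,K_p,R,\mathcal Q$ and $X_d-X_d'$ are diagonal with positive diagonal entries, $\overline E_f,\mathcal R\in\mathbb R^n$ are constant, the susceptances satisfy $B_{ij}=B_{ji}$, and $B_{ij}<0$ on lines; for a line $k$ with ends $i,j$, $\Gamma(V)=\mathrm{diag}(\Gamma_k)$ with $\Gamma_k=V_iV_jB_{ij}$; $E_{ii}=\frac1{X_{di}-X_{di}'}-B_{ii}$,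 $E_{ij}(\eta)=B_{ij}\cos\eta_k$ if line $k$ joins $i\ne j$, and $E_{ij}=0$ otherwise; $\mathcal L^{com}$ is the Laplacian matrix of a communication graph (possibly weighted and directed, with nonnegative weights). Let $M_1>0$, $M_2\ge0$, $M_3>0$ be diagonal matrices, $M_4=-(M_2+M_3)$, $A=(M_2+M_3)^{-1}M_1\mathcal Q$, and $$\sigma=M_1f+M_2P_t+M_3P_g+M_4\theta .$$ Write $\dot\sigma$ for the derivative of $\sigma$ along the system, and $\ddot\sigma=\phi+Gw$ with $G=M_3T_g^{-1}$, where $\phi$ collects all terms of $\ddot\sigma$ that do not contain $w$. Suppose that the demand $P_d(t)$ is locally absolutely continuous on $[0,\infty)$ with $|P_{di}(t)|\le\mathcal D_i$ for all $t\ge 0$, $\mathcal D_i>0$. For each area $i$ let $\Phi_i>0$ and $0<G_{\min_i}\le G_{ii}\le G_{\max_i}$ be constants, let $$\alpha_i^*\in(0,1]\cap\Big(0,\tfrac{3G_{\min_i}}{G_{\max_i}}\Big),\qquad W_{\max_i}>\max\Big(\frac{\Phi_i}{\alpha_i^*G_{\min_i}},\ \frac{4\Phi_i}{3G_{\min_i}-\alpha_i^*G_{\max_i}}\Big),$$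 and apply in each area the suboptimal second order sliding mode (SSOSM) law, with $\xi_1=\sigma$, $$w_i=-\alpha_iW_{\max_i}\,\mathrm{sgn}\big(\xi_{1,i}-\tfrac12\xi_{1,\max_i}\big),$$ where $\alpha_i=\alpha_i^*$ if $(\xi_{1,i}-\frac12\xi_{1,\max_i})(\xi_{1,\max_i}-\xi_{1,i})>0$ and $\alpha_i=1$ otherwise, and where $\xi_{1,\max_i}(t)$ is the value of $\xi_{1,i}$ at the last time $\tau\in(0,t]$ with $\dot\xi_{1,i}(\tau)=0$ (and $\xi_{1,i}(0)$ if there is no such time). Then for every closed-loop solution on $[0,\infty)$ in the sense of Filippov, from any initial state, along which $|\phi_i|\le\Phi_i$ for all $i$ and almost all $t\geq 0$, there is a finite time $T_r\ge0$ such that for all $t\ge T_r$ the solution lies on the sliding manifold $\{\sigma=\dot\sigma=0\}$ and $$P_g=-M_3^{-1}\big(M_1f+M_2P_t+M_4\theta\big).$$ -/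

import Mathlib

open Set MeasureTheory

noncomputable section

/-- Data of the power network.  `ι` indexes the control areas, `E` the transmission lines; the ends
of a line `k` are labelled (arbitrarily) `pos k` and `neg k`, and the resulting undirected graph is
simple and connected.  `B i j` is the susceptance of the line joining `i` and `j`, and `B i i` the
self-susceptance of area `i`. -/
structure PowerNetwork (ι E : Type*) where
  /-- positive end of a line -/
  pos : E → ι
  /-- negative end of a line -/
  neg : E → ι
  pos_ne_neg : ∀ k, pos k ≠ neg k
  simple : Function.Injective fun k => s(pos k, neg k)
  connected : (SimpleGraph.fromEdgeSet (Set.range fun k => s(pos k, neg k))).Connected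
  /-- susceptances -/
  B : ι → ι → ℝ
  B_symm : ∀ i j, B i j = B j i
  B_neg : ∀ k, B (pos k) (neg k) < 0
  /-- time constants of the control areas -/
  Tp : ι → ℝ
  /-- time constants of the turbines -/
  Tt : ι → ℝ
  /-- time constants of the governors -/
  Tg : ι → ℝ
  /-- direct axis transient open-circuit constants -/
  TV : ι → ℝ
  /-- gains of the control areas -/
  Kp : ι → ℝ
  /-- speed regulation coefficients -/
  R : ι → ℝ
  /-- direct synchronous reactances -/
  Xd : ι → ℝ
  /-- direct synchronous transient reactances -/
  Xd' : ι → ℝ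
  /-- constant exciter voltages -/
  Ef : ι → ℝ
  Tp_pos : ∀ i, 0 < Tp i
  Tt_pos : ∀ i, 0 < Tt i
  Tg_pos : ∀ i, 0 < Tg i
  TV_pos : ∀ i, 0 < TV i
  Kp_pos : ∀ i, 0 < Kp i
  R_pos : ∀ i, 0 < R i
  Xd'_lt_Xd : ∀ i, Xd' i < Xd i

/-- Data of the distributed controller: diagonal entries of `T_θ`, of the cost matrix `𝒬`, of the
matrices `M₁ > 0`, `M₂ ≥ 0`, `M₃ > 0`, the linear cost coefficients `ℛ`, and the weights of the
communication graph (`com i j` is the weight with which area `i` uses the information of area `j`;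
for an undirected unweighted graph this is the `0`-`1` adjacency matrix). -/
structure ControlDesign (ι : Type*) where
  Tθ : ι → ℝ
  Q : ι → ℝ
  Rc : ι → ℝ
  com : Matrix ι ι ℝ
  M₁ : ι → ℝ
  M₂ : ι → ℝ
  M₃ : ι → ℝ
  Tθ_pos : ∀ i, 0 < Tθ i
  Q_pos : ∀ i, 0 < Q i
  com_nonneg : ∀ i j, 0 ≤ com i j
  M₁_pos : ∀ i, 0 < M₁ i
  M₂_nonneg : ∀ i, 0 ≤ M₂ i
  M₃_pos : ∀ i, 0 < M₃ i

/-- State of the network, the turbine-governors, the controller dynamics `θ`, and the integrator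
`u` in front of the governor. -/
structure PowerState (ι E : Type*) where
  η : E → ℝ
  f : ι → ℝ
  V : ι → ℝ
  Pt : ι → ℝ
  Pg : ι → ℝ
  θ : ι → ℝ
  u : ι → ℝ

section Model

variable {ι E : Type*} [Fintype ι] [DecidableEq ι] [Fintype E]

/-- Incidence matrix `ℬ` of the network. -/
def PowerNetwork.incidence (N : PowerNetwork ι E) : Matrix ι E ℝ := fun i k =>
  if i = N.pos k then 1 else if i = N.neg k then -1 else 0

/-- Diagonal entries of `Γ(V)`. -/
def PowerNetwork.Γ (N : PowerNetwork ι E) (V : ι → ℝ) (k : E) : ℝ :=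
  V (N.pos k) * V (N.neg k) * N.B (N.pos k) (N.neg k)

/-- The matrix `E(η)`.  Off the diagonal at most one summand is not zero. -/
def PowerNetwork.Emat (N : PowerNetwork ι E) (η : E → ℝ) : Matrix ι ι ℝ := fun i j =>
  if i = j then 1 / (N.Xd i - N.Xd' i) - N.B i i
  else ∑ k, if s(N.pos k, N.neg k) = s(i, j) then N.B i j * Real.cos (η k) else 0

/-- `M₄ = -(M₂ + M₃)`. -/
def ControlDesign.M₄ (C : ControlDesign ι) (i : ι) : ℝ := -(C.M₂ i + C.M₃ i)

/-- `A = (M₂ + M₃)⁻¹ M₁ 𝒬`. -/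
def ControlDesign.A (C : ControlDesign ι) (i : ι) : ℝ := (C.M₂ i + C.M₃ i)⁻¹ * C.M₁ i * C.Q i

/-- Laplacian matrix `ℒ^com` of the communication graph. -/
def ControlDesign.lap (C : ControlDesign ι) : Matrix ι ι ℝ :=
  Matrix.diagonal (fun i => ∑ j, C.com i j) - C.com

/-! ### The vector field -/

/-- `η̇ = ℬᵀ f`. -/
def ηDot (N : PowerNetwork ι E) (x : PowerState ι E) : E → ℝ :=
  N.incidence.transpose.mulVec x.f

/-- `T_p ḟ = -f + K_p (P_t - P_d - ℬ Γ(V) sin η)`; `d` is the current value of `P_d`. -/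
def fDot (N : PowerNetwork ι E) (x : PowerState ι E) (d : ι → ℝ) (i : ι) : ℝ :=
  (N.Tp i)⁻¹ * (-x.f i + N.Kp i *
    (x.Pt i - d i - N.incidence.mulVec (fun k => N.Γ x.V k * Real.sin (x.η k)) i))

/-- `T_V V̇ = -(X_d - X_d') E(η) V + Ē_f`. -/
def VDot (N : PowerNetwork ι E) (x : PowerState ι E) (i : ι) : ℝ :=
  (N.TV i)⁻¹ * (-(N.Xd i - N.Xd' i) * (N.Emat x.η).mulVec x.V i + N.Ef i)

/-- `T_t Ṗ_t = -P_t + P_g`. -/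
def PtDot (N : PowerNetwork ι E) (x : PowerState ι E) (i : ι) : ℝ :=
  (N.Tt i)⁻¹ * (-x.Pt i + x.Pg i)

/-- `T_g Ṗ_g = -R⁻¹ f - P_g + u`. -/
def PgDot (N : PowerNetwork ι E) (x : PowerState ι E) (i : ι) : ℝ :=
  (N.Tg i)⁻¹ * (-(N.R i)⁻¹ * x.f i - x.Pg i + x.u i)

/-- `T_θ θ̇ = -θ + P_t - A ℒ^com (𝒬 θ + ℛ)`. -/
def θDot (C : ControlDesign ι) (x : PowerState ι E) (i : ι) : ℝ :=
  (C.Tθ i)⁻¹ * (-x.θ i + x.Pt i - C.A i * C.lap.mulVec (fun j => C.Q j * x.θ j + C.Rc j) i)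

/-! ### The sliding function and its derivatives along the system -/

/-- Sliding function `σ = M₁ f + M₂ P_t + M₃ P_g + M₄ θ`. -/
def slidingFn (C : ControlDesign ι) (x : PowerState ι E) (i : ι) : ℝ :=
  C.M₁ i * x.f i + C.M₂ i * x.Pt i + C.M₃ i * x.Pg i + C.M₄ i * x.θ i

/-- `σ̇`, the derivative of `σ` along the system. -/
def slidingFnDot (N : PowerNetwork ι E) (C : ControlDesign ι) (x : PowerState ι E) (d : ι → ℝ)
    (i : ι) : ℝ :=
  C.M₁ i * fDot N x d i + C.M₂ i * PtDot N x i + C.M₃ i * PgDot N x i + C.M₄ i * θDot C x i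

/-- Sliding manifold `σ = σ̇ = 0`, when the current value of `P_d` is `d`. -/
def slidingManifold (N : PowerNetwork ι E) (C : ControlDesign ι) (d : ι → ℝ) :
    Set (PowerState ι E) :=
  {x | slidingFn C x = 0 ∧ slidingFnDot N C x d = 0}

/-- Time derivative of `Γ(V) sin η` along the system. -/
def flowDot (N : PowerNetwork ι E) (x : PowerState ι E) (k : E) : ℝ :=
  (VDot N x (N.pos k) * x.V (N.neg k) + x.V (N.pos k) * VDot N x (N.neg k)) *
      N.B (N.pos k) (N.neg k) * Real.sin (x.η k) +
    N.Γ x.V k * (Real.cos (x.η k) * ηDot N x k)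

/-- Second derivative of `f` along the system; `d`, `d'` are the values of `P_d`, `Ṗ_d`. -/
def fDDot (N : PowerNetwork ι E) (x : PowerState ι E) (d d' : ι → ℝ) (i : ι) : ℝ :=
  (N.Tp i)⁻¹ * (-fDot N x d i + N.Kp i *
    (PtDot N x i - d' i - N.incidence.mulVec (flowDot N x) i))

/-- The part `φ` of `σ̈ = φ + G w` that does not contain `w = u̇`. -/
def driftφ (N : PowerNetwork ι E) (C : ControlDesign ι) (x : PowerState ι E) (d d' : ι → ℝ)
    (i : ι) : ℝ :=
  C.M₁ i * fDDot N x d d' i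
  + C.M₂ i * ((N.Tt i)⁻¹ * (-PtDot N x i + PgDot N x i))
  + C.M₃ i * ((N.Tg i)⁻¹ * (-(N.R i)⁻¹ * fDot N x d i - PgDot N x i))
  + C.M₄ i * ((C.Tθ i)⁻¹ * (-θDot C x i + PtDot N x i
      - C.A i * C.lap.mulVec (fun j => C.Q j * θDot C x j) i))

/-- Diagonal entries of `G = M₃ T_g⁻¹`. -/
def gainG (N : PowerNetwork ι E) (C : ControlDesign ι) (i : ι) : ℝ := C.M₃ i * (N.Tg i)⁻¹

/-- The auxiliary system: where a trajectory satisfies the differential equations with `u̇ = w`, one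
has `σ̈ = φ + G w`. -/
theorem hasDerivAt_slidingFnDot (N : PowerNetwork ι E) (C : ControlDesign ι)
    (x : ℝ → PowerState ι E) (d : ℝ → ι → ℝ) (d' w : ι → ℝ) (t : ℝ)
    (hη : ∀ k, HasDerivAt (fun s => (x s).η k) (ηDot N (x t) k) t)
    (hf : ∀ i, HasDerivAt (fun s => (x s).f i) (fDot N (x t) (d t) i) t)
    (hV : ∀ i, HasDerivAt (fun s => (x s).V i) (VDot N (x t) i) t)
    (hPt : ∀ i, HasDerivAt (fun s => (x s).Pt i) (PtDot N (x t) i) t)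
    (hPg : ∀ i, HasDerivAt (fun s => (x s).Pg i) (PgDot N (x t) i) t)
    (hθ : ∀ i, HasDerivAt (fun s => (x s).θ i) (θDot C (x t) i) t)
    (hu : ∀ i, HasDerivAt (fun s => (x s).u i) (w i) t)
    (hd : ∀ i, HasDerivAt (fun s => d s i) (d' i) t) (i : ι) :
    HasDerivAt (fun s => slidingFnDot N C (x s) (d s) i)
      (driftφ N C (x t) (d t) d' i + gainG N C i * w i) t := by
  have hflow : ∀ k, HasDerivAt (fun s => N.Γ (x s).V k * Real.sin ((x s).η k))
      (flowDot N (x t) k) t := fun k =>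
    ((((hV (N.pos k)).mul (hV (N.neg k))).mul_const (N.B (N.pos k) (N.neg k))).mul
      ((hη k).sin)).congr_deriv (by simp only [flowDot, PowerNetwork.Γ, Pi.mul_apply])
  have hinc : HasDerivAt
      (fun s => N.incidence.mulVec (fun k => N.Γ (x s).V k * Real.sin ((x s).η k)) i)
      (N.incidence.mulVec (flowDot N (x t)) i) t :=
    HasDerivAt.fun_sum fun k _ => (hflow k).const_mul _
  have hlap : HasDerivAt
      (fun s => C.lap.mulVec (fun j => C.Q j * (x s).θ j + C.Rc j) i)
      (C.lap.mulVec (fun j => C.Q j * θDot C (x t) j) i) t :=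
    HasDerivAt.fun_sum fun j _ => (((hθ j).const_mul _).add_const _).const_mul _
  have h1 := (((hf i).neg.add ((((hPt i).sub (hd i)).sub hinc).const_mul (N.Kp i))).const_mul
    (N.Tp i)⁻¹).const_mul (C.M₁ i)
  have h2 := (((hPt i).neg.add (hPg i)).const_mul (N.Tt i)⁻¹).const_mul (C.M₂ i)
  have h3 := (((((hf i).const_mul (-(N.R i)⁻¹)).sub (hPg i)).add (hu i)).const_mul
    (N.Tg i)⁻¹).const_mul (C.M₃ i)
  have h4 := ((((hθ i).neg.add (hPt i)).sub (hlap.const_mul (C.A i))).const_mul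
    (C.Tθ i)⁻¹).const_mul (C.M₄ i)
  refine (((h1.add h2).add h3).add h4).congr_deriv ?_
  simp only [driftφ, gainG, fDDot]
  ring

end Model

/-! ### The suboptimal second order sliding mode law and Filippov solutions -/

/-- Filippov regularization of a real function: the intersection, over `δ > 0` and over null sets
`S`, of the closed convex hulls of the values on the `δ`-ball without `S`. -/
def filippov (g : ℝ → ℝ) (y : ℝ) : Set ℝ :=
  ⋂ (δ : ℝ) (_ : 0 < δ) (S : Set ℝ) (_ : volume S = 0),
    closure (convexHull ℝ (g '' (Metric.ball y δ \ S)))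

/-- Switching of `α` between `α*` and `1`; `m` is the stored extremal value of `ξ₁ = y`. -/
def switchα (αs m y : ℝ) : ℝ :=
  if 0 < (y - m / 2) * (m - y) then αs else 1

/-- `w = -α W_max sgn (ξ₁ - ξ₁,max / 2)` with `ξ₁ = y` and `ξ₁,max = m`. -/
def ssosmLaw (αs W m y : ℝ) : ℝ :=
  -(switchα αs m y * W * Real.sign (y - m / 2))

/-- The stored value `ξ₁,max` at time `t`: initially `ξ₁ 0`, and updated to the current value of
`ξ₁` at every time where `ξ̇₁` vanishes.  It only uses the values of `ξ₁` up to time `t`. -/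
def lastExtremalValue (ξ₁ : ℝ → ℝ) (t : ℝ) : ℝ :=
  ξ₁ (sSup {τ | τ ∈ Icc 0 t ∧ (τ = 0 ∨ deriv ξ₁ τ = 0)})

/-- `g` is absolutely continuous on every compact subinterval of `[0, ∞)`. -/
def LocallyACOnNonneg (g : ℝ → ℝ) : Prop :=
  ∀ T, 0 ≤ T → AbsolutelyContinuousOnInterval g 0 T

/-- `x` is a Filippov solution on `[0, ∞)` of the power network with demand `Pd`, in closed loop
with the law above in every area `i`, with parameters `αs i` and `W i`: it is locally absolutely
continuous, and for almost every `t > 0` the differential equations hold with `u̇` in the Filippov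
regularization of the law.  (All other components of the right-hand side are continuous in the
state, and the law of area `i` depends on the state through `σ_i` alone, so that the regularization
can be taken in the variable `σ_i`.) -/
structure IsClosedLoopSolution {ι E : Type*} [Fintype ι] [DecidableEq ι] [Fintype E]
    (N : PowerNetwork ι E) (C : ControlDesign ι) (αs W : ι → ℝ) (Pd : ℝ → ι → ℝ)
    (x : ℝ → PowerState ι E) : Prop where
  ac_η : ∀ k, LocallyACOnNonneg fun t => (x t).η k
  ac_f : ∀ i, LocallyACOnNonneg fun t => (x t).f i
  ac_V : ∀ i, LocallyACOnNonneg fun t => (x t).V i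
  ac_Pt : ∀ i, LocallyACOnNonneg fun t => (x t).Pt i
  ac_Pg : ∀ i, LocallyACOnNonneg fun t => (x t).Pg i
  ac_θ : ∀ i, LocallyACOnNonneg fun t => (x t).θ i
  ac_u : ∀ i, LocallyACOnNonneg fun t => (x t).u i
  ode_η : ∀ k, ∀ᵐ t ∂volume.restrict (Ioi (0 : ℝ)),
    HasDerivAt (fun s => (x s).η k) (ηDot N (x t) k) t
  ode_f : ∀ i, ∀ᵐ t ∂volume.restrict (Ioi (0 : ℝ)),
    HasDerivAt (fun s => (x s).f i) (fDot N (x t) (Pd t) i) t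
  ode_V : ∀ i, ∀ᵐ t ∂volume.restrict (Ioi (0 : ℝ)),
    HasDerivAt (fun s => (x s).V i) (VDot N (x t) i) t
  ode_Pt : ∀ i, ∀ᵐ t ∂volume.restrict (Ioi (0 : ℝ)),
    HasDerivAt (fun s => (x s).Pt i) (PtDot N (x t) i) t
  ode_Pg : ∀ i, ∀ᵐ t ∂volume.restrict (Ioi (0 : ℝ)),
    HasDerivAt (fun s => (x s).Pg i) (PgDot N (x t) i) t
  ode_θ : ∀ i, ∀ᵐ t ∂volume.restrict (Ioi (0 : ℝ)),
    HasDerivAt (fun s => (x s).θ i) (θDot C (x t) i) t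
  ode_u : ∀ i, ∀ᵐ t ∂volume.restrict (Ioi (0 : ℝ)),
    ∃ w ∈ filippov (ssosmLaw (αs i) (W i)
        (lastExtremalValue (fun s => slidingFn C (x s) i) t)) (slidingFn C (x t) i),
      HasDerivAt (fun s => (x s).u i) w t

end

/-!
In each area the closed loop reduces to a scalar problem for `y = σ_i` and `v = σ̇_i`.  The function
`v` is a combination of products of absolutely continuous functions and of sines of them, so it is
absolutely continuous; as `σ_i` is absolutely continuous with almost everywhere derivative `v`, it
is differentiable at all positive times, with derivative `v`.  Hence the stored value is that of `y`
at the last zero of `v`.  The Filippov values of the law away from the switching point give bounds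
on `v̇ = φ + G w` (`AccelBound`, with `c₁ = α* W G - Φ`, `C₁ = α* W G + Φ`, `c₂ = W G - Φ`), and these
are all that is used (`IsSuboptimalTrajectory`, invariant under a change of sign).

After an extremum at a value `M > 0` the motion is a half turn (`half_turn`): from `M` to `M / 2` the
deceleration lies between `c₁` and `C₁`, and below `M / 2` the motion is braked at rate at least
`c₂`.  So the next extremal value lies between `-(C₁ / c₂ - 1) M / 2` and `M / 2`, and is reached in a
time of order `√M`.  The hypotheses on `W` give `c₁ > 0` and `C₁ < 3 c₂`, so the
moduli of the extremal values contract by a factor less than one.  A first zero of `v` exists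
(`exists_first_zero`), since the law also brakes the initial motion, and the times of successive
extrema then form a Cauchy sequence, and at its limit `y = v = 0`
(`exists_time_forall_eq_zero`).

The law is discontinuous at the origin and solutions need not be unique, so it remains to see that
the origin is not left again (`eq_zero_of_rest`).  At a time where `|y|` would be maximal and
positive, zeros of `v` cannot accumulate from the left, since the law decelerates there; and after
the last zero of `v` before that time, `|y|` has only become smaller.
-/

/-! ### Absolutely continuous functions on the half-line -/

namespace LocallyACOnNonneg

variable {g h : ℝ → ℝ}

theorem const (c : ℝ) : LocallyACOnNonneg fun _ => c := fun _ _ =>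
  (LipschitzWith.const c).lipschitzOnWith.absolutelyContinuousOnInterval

theorem add (hg : LocallyACOnNonneg g) (hh : LocallyACOnNonneg h) :
    LocallyACOnNonneg fun t => g t + h t := fun T hT => (hg T hT).add (hh T hT)

theorem neg (hg : LocallyACOnNonneg g) : LocallyACOnNonneg fun t => -g t :=
  fun T hT => (hg T hT).neg

theorem sub (hg : LocallyACOnNonneg g) (hh : LocallyACOnNonneg h) :
    LocallyACOnNonneg fun t => g t - h t := fun T hT => (hg T hT).sub (hh T hT)

theorem mul (hg : LocallyACOnNonneg g) (hh : LocallyACOnNonneg h) :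
    LocallyACOnNonneg fun t => g t * h t := fun T hT => (hg T hT).mul (hh T hT)

theorem const_mul (c : ℝ) (hg : LocallyACOnNonneg g) : LocallyACOnNonneg fun t => c * g t :=
  fun T hT => (hg T hT).const_mul c

theorem sum {κ : Type*} (s : Finset κ) {G : κ → ℝ → ℝ} (hG : ∀ k, LocallyACOnNonneg (G k)) :
    LocallyACOnNonneg fun t => ∑ k ∈ s, G k t := by
  classical
  induction s using Finset.induction_on with
  | empty => simpa using const 0
  | insert k s hk ih => simpa [Finset.sum_insert hk] using (hG k).add ih

theorem sin (hg : LocallyACOnNonneg g) : LocallyACOnNonneg fun t => Real.sin (g t) := by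
  intro T hT
  refine squeeze_zero (fun I => Finset.sum_nonneg fun _ _ => dist_nonneg)
    (fun I => Finset.sum_le_sum fun i _ => ?_) (hg T hT)
  simpa [Real.dist_eq] using Real.abs_sin_sub_sin_le _ _

theorem mulVec {κ₁ κ₂ : Type*} [Fintype κ₂] (M : Matrix κ₁ κ₂ ℝ) {G : κ₂ → ℝ → ℝ}
    (hG : ∀ k, LocallyACOnNonneg (G k)) (i : κ₁) :
    LocallyACOnNonneg fun t => M.mulVec (fun k => G k t) i :=
  sum Finset.univ fun k => (hG k).const_mul (M i k)

theorem continuousOn (hg : LocallyACOnNonneg g) : ContinuousOn g (Ici 0) := by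
  intro t ht
  have ht0 : (0 : ℝ) ≤ t := ht
  have h1 := (hg (t + 1) (by linarith)).continuousOn
  rw [uIcc_of_le (by linarith)] at h1
  refine (h1 t ⟨ht0, by linarith⟩).mono_of_mem_nhdsWithin ?_
  filter_upwards [self_mem_nhdsWithin, mem_nhdsWithin_of_mem_nhds (Iio_mem_nhds (lt_add_one t))]
    with s hs hs' using ⟨hs, le_of_lt hs'⟩

theorem ae_differentiableAt (hg : LocallyACOnNonneg g) :
    ∀ᵐ t ∂volume.restrict (Ioi (0 : ℝ)), DifferentiableAt ℝ g t := by
  rw [ae_restrict_iff' measurableSet_Ioi]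
  have h : ∀ᵐ t : ℝ, ∀ n : ℕ, t ∈ uIcc (0 : ℝ) n → DifferentiableAt ℝ g t :=
    ae_all_iff.2 fun n => (hg n n.cast_nonneg).ae_differentiableAt
  filter_upwards [h] with t ht ht0
  obtain ⟨n, hn⟩ := exists_nat_ge t
  exact ht n (by rw [uIcc_of_le n.cast_nonneg]; exact ⟨le_of_lt ht0, hn⟩)

theorem absolutelyContinuousOnInterval (hg : LocallyACOnNonneg g) {s t : ℝ} (hs : 0 ≤ s)
    (hst : s ≤ t) : AbsolutelyContinuousOnInterval g s t :=
  (hg t (hs.trans hst)).mono (by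
    rw [uIcc_of_le hst, uIcc_of_le (hs.trans hst)]; exact Icc_subset_Icc_left hs)

/-- An almost everywhere bound on the derivative of a locally absolutely continuous function bounds
its increments. -/
theorem sub_le_of_ae_deriv_le (hg : LocallyACOnNonneg g) {s t c : ℝ} (hs : 0 ≤ s) (hst : s ≤ t)
    (hc : ∀ᵐ τ ∂volume.restrict (Ioi (0 : ℝ)), τ ∈ Ioo s t → deriv g τ ≤ c) :
    g t - g s ≤ c * (t - s) := by
  have hac := hg.absolutelyContinuousOnInterval hs hst
  rw [← hac.integral_deriv_eq_sub]
  have h1 : ∫ τ in s..t, deriv g τ ≤ ∫ _ in s..t, c := by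
    refine intervalIntegral.integral_mono_ae_restrict hst hac.intervalIntegrable_deriv
      intervalIntegrable_const ?_
    rw [Filter.EventuallyLE, ← Measure.restrict_congr_set Ioo_ae_eq_Icc,
      ae_restrict_iff' measurableSet_Ioo]
    rw [ae_restrict_iff' measurableSet_Ioi] at hc
    filter_upwards [hc] with τ hτ hmem using hτ (lt_of_le_of_lt hs hmem.1) hmem
  rw [intervalIntegral.integral_const, smul_eq_mul] at h1
  linarith

/-- A locally absolutely continuous function whose almost everywhere derivative agrees with a
continuous function is differentiable at every positive time. -/
theorem hasDerivAt_of_ae (hg : LocallyACOnNonneg g) {g' : ℝ → ℝ}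
    (hg' : ContinuousOn g' (Ici 0))
    (hd : ∀ᵐ t ∂volume.restrict (Ioi (0 : ℝ)), HasDerivAt g (g' t) t) {t : ℝ} (ht : 0 < t) :
    HasDerivAt g (g' t) t := by
  have hint : ∀ s, 0 ≤ s → IntervalIntegrable g' volume 0 s := fun s hs =>
    (hg'.mono (by rw [uIcc_of_le hs]; exact Icc_subset_Ici_self)).intervalIntegrable
  have hrep : ∀ s, 0 ≤ s → g s = g 0 + ∫ τ in (0 : ℝ)..s, g' τ := by
    intro s hs
    have hac := hg s hs
    have heq : ∫ τ in (0 : ℝ)..s, deriv g τ = ∫ τ in (0 : ℝ)..s, g' τ := by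
      refine intervalIntegral.integral_congr_ae ?_
      rw [ae_restrict_iff' measurableSet_Ioi] at hd
      filter_upwards [hd] with τ hτ hmem
      rw [uIoc_of_le hs] at hmem
      exact (hτ hmem.1).deriv
    rw [← heq, hac.integral_deriv_eq_sub]; ring
  have hnhds : Ici (0 : ℝ) ∈ nhds t := Ici_mem_nhds ht
  have h1 : HasDerivAt (fun s => g 0 + ∫ τ in (0 : ℝ)..s, g' τ) (g' t) t := by
    refine HasDerivAt.const_add _ (intervalIntegral.integral_hasDerivAt_right (hint t ht.le) ?_
      (hg'.continuousAt hnhds))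
    exact (hg'.mono Ioi_subset_Ici_self).stronglyMeasurableAtFilter isOpen_Ioi t ht
  exact h1.congr_of_eventuallyEq (Filter.mem_of_superset hnhds fun s hs => hrep s hs)

end LocallyACOnNonneg

/-! ### Filippov values of the switching law -/

theorem filippov_subset_Icc {g : ℝ → ℝ} {y δ lo hi : ℝ} (hδ : 0 < δ)
    (hg : ∀ z ∈ Metric.ball y δ, g z ∈ Icc lo hi) : filippov g y ⊆ Icc lo hi := by
  intro w hw
  simp only [filippov, mem_iInter] at hw
  refine closure_minimal (convexHull_min ?_ (convex_Icc lo hi)) isClosed_Icc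
    (hw δ hδ ∅ measure_empty)
  rintro _ ⟨z, hz, rfl⟩
  exact hg z hz.1

theorem ssosmLaw_neg (αs W m y : ℝ) : ssosmLaw αs W (-m) (-y) = -ssosmLaw αs W m y := by
  have h1 : (-y - -m / 2) * (-m - -y) = (y - m / 2) * (m - y) := by ring
  have h2 : -y - -m / 2 = -(y - m / 2) := by ring
  simp only [ssosmLaw, switchα, h1]
  rw [h2, Real.sign_neg]
  ring

theorem neg_mem_filippov {g h : ℝ → ℝ} {y w : ℝ} (hgh : ∀ z, h (-z) = -g z)
    (hw : w ∈ filippov g y) : -w ∈ filippov h (-y) := by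
  simp only [filippov, mem_iInter] at hw ⊢
  intro δ hδ S hS
  have hS' : volume (-S) = 0 := by rw [Measure.measure_neg, hS]
  have hset : h '' (Metric.ball (-y) δ \ S) = -(g '' (Metric.ball y δ \ -S)) := by
    ext a
    simp only [mem_image, mem_neg, mem_sdiff, Metric.mem_ball, Real.dist_eq]
    constructor
    · rintro ⟨z, ⟨hz, hzS⟩, rfl⟩
      refine ⟨-z, ⟨?_, by simpa using hzS⟩, by
        rw [← neg_neg (g (-z)), ← hgh, neg_neg]⟩
      rw [← abs_neg]; convert hz using 2; ring
    · rintro ⟨z, ⟨hz, hzS⟩, hza⟩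
      refine ⟨-z, ⟨?_, hzS⟩, by rw [hgh, hza, neg_neg]⟩
      rw [← abs_neg]; convert hz using 2; ring
  rw [hset, convexHull_neg]
  exact map_mem_closure continuous_neg (hw δ hδ (-S) hS') fun a ha => neg_mem_neg.2 ha

section FilippovValues

variable {αs W m y : ℝ}

/-- Beyond half of the stored value the law decelerates, with the full or the reduced amplitude. -/
theorem filippov_ssosmLaw_of_half_lt (hα : αs ≤ 1) (hW : 0 ≤ W) (hy : m / 2 < y) :
    filippov (ssosmLaw αs W m) y ⊆ Icc (-W) (-(αs * W)) := by
  refine filippov_subset_Icc (sub_pos.2 hy) fun z hz => ?_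
  rw [Metric.mem_ball, Real.dist_eq, abs_lt] at hz
  have hαW : αs * W ≤ W := mul_le_of_le_one_left hW hα
  simp only [ssosmLaw, switchα, Real.sign_of_pos (show 0 < z - m / 2 by linarith)]
  split_ifs <;> constructor <;> linarith

/-- Between half of the stored value and the stored value the amplitude is the reduced one. -/
theorem filippov_ssosmLaw_of_half_lt_of_lt (hy : m / 2 < y) (hym : y < m) :
    filippov (ssosmLaw αs W m) y ⊆ Icc (-(αs * W)) (-(αs * W)) := by
  refine filippov_subset_Icc (lt_min (sub_pos.2 hy) (sub_pos.2 hym)) fun z hz => ?_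
  rw [Metric.mem_ball, Real.dist_eq, lt_min_iff, abs_lt, abs_lt] at hz
  have h1 : 0 < z - m / 2 := by linarith
  have h2 : 0 < m - z := by linarith
  simp [ssosmLaw, switchα, Real.sign_of_pos h1, mul_pos h1 h2]

/-- Below half of a nonnegative stored value the law accelerates with full amplitude. -/
theorem filippov_ssosmLaw_of_lt_half (hm : 0 ≤ m) (hy : y < m / 2) :
    filippov (ssosmLaw αs W m) y ⊆ Icc W W := by
  refine filippov_subset_Icc (sub_pos.2 hy) fun z hz => ?_
  rw [Metric.mem_ball, Real.dist_eq, abs_lt] at hz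
  have h1 : z - m / 2 < 0 := by linarith
  have h2 : 0 < m - z := by linarith
  have h3 : ¬ 0 < (z - m / 2) * (m - z) := (mul_neg_of_neg_of_pos h1 h2).not_gt
  simp [ssosmLaw, switchα, Real.sign_of_neg h1, h3]

end FilippovValues

/-! ### Scalar trajectories under the suboptimal law -/

/-- Bounds on the acceleration `a` of the sliding function at the value `y`, when the stored
extremal value `m` is nonnegative: deceleration of at least `c₁` beyond `m / 2`, of at most `C₁`
between `m / 2` and `m`, and acceleration of at least `c₂` below `m / 2`. -/
def AccelBound (c₁ C₁ c₂ m y a : ℝ) : Prop :=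
  0 ≤ m → (m / 2 < y → a ≤ -c₁) ∧ (m / 2 < y → y < m → -C₁ ≤ a) ∧ (y < m / 2 → c₂ ≤ a)

/-- A scalar trajectory `y` with velocity `v` under the suboptimal law with stored extremal value
`m`.  All that matters about the closed loop are the bounds `AccelBound` on the acceleration, for
either sign of `m`, and that `m` is the value of `y` at the last zero of `v` (or at time `0`). -/
structure IsSuboptimalTrajectory (c₁ C₁ c₂ : ℝ) (y v m : ℝ → ℝ) : Prop where
  ac_v : LocallyACOnNonneg v
  cont_y : ContinuousOn y (Ici 0)
  hasDerivAt_y : ∀ t, 0 < t → HasDerivAt y (v t) t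
  stored : ∀ a t, 0 ≤ a → a ≤ t → (a = 0 ∨ v a = 0) → (∀ s ∈ Ioc a t, v s ≠ 0) → m t = y a
  accel : ∀ᵐ t ∂volume.restrict (Ioi (0 : ℝ)), AccelBound c₁ C₁ c₂ (m t) (y t) (deriv v t) ∧
    AccelBound c₁ C₁ c₂ (-m t) (-y t) (-deriv v t)

namespace IsSuboptimalTrajectory

variable {c₁ C₁ c₂ : ℝ} {y v m : ℝ → ℝ}

theorem neg (h : IsSuboptimalTrajectory c₁ C₁ c₂ y v m) :
    IsSuboptimalTrajectory c₁ C₁ c₂ (fun t => -y t) (fun t => -v t) (fun t => -m t) where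
  ac_v := h.ac_v.neg
  cont_y := h.cont_y.neg
  hasDerivAt_y t ht := (h.hasDerivAt_y t ht).neg
  stored a t ha hat hz hs := by
    rw [h.stored a t ha hat (by simpa using hz) (by simpa using hs)]
  accel := by
    filter_upwards [h.accel] with t ht
    simpa [deriv.fun_neg, and_comm] using ht

theorem cont_v (h : IsSuboptimalTrajectory c₁ C₁ c₂ y v m) : ContinuousOn v (Ici 0) :=
  h.ac_v.continuousOn

theorem v_sub_le (h : IsSuboptimalTrajectory c₁ C₁ c₂ y v m) {s t c : ℝ} (hs : 0 ≤ s)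
    (hst : s ≤ t) (H : ∀ τ ∈ Ioo s t, ∀ a, AccelBound c₁ C₁ c₂ (m τ) (y τ) a → a ≤ c) :
    v t - v s ≤ c * (t - s) := by
  refine h.ac_v.sub_le_of_ae_deriv_le hs hst ?_
  filter_upwards [h.accel] with τ hτ hmem using H τ hmem _ hτ.1

theorem le_v_sub (h : IsSuboptimalTrajectory c₁ C₁ c₂ y v m) {s t c : ℝ} (hs : 0 ≤ s)
    (hst : s ≤ t) (H : ∀ τ ∈ Ioo s t, ∀ a, AccelBound c₁ C₁ c₂ (m τ) (y τ) a → c ≤ a) :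
    c * (t - s) ≤ v t - v s := by
  have h1 : -v t - -v s ≤ -c * (t - s) := by
    refine h.ac_v.neg.sub_le_of_ae_deriv_le hs hst ?_
    filter_upwards [h.accel] with τ hτ hmem
    rw [deriv.fun_neg]
    exact neg_le_neg (H τ hmem _ hτ.1)
  linarith

/-- Integration of an affine upper bound on the velocity. -/
theorem y_sub_le (h : IsSuboptimalTrajectory c₁ C₁ c₂ y v m) {s t A c : ℝ} (hs : 0 ≤ s)
    (hst : s ≤ t) (H : ∀ τ ∈ Ioo s t, v τ ≤ A + c * (τ - s)) :
    y t - y s ≤ A * (t - s) + c * (t - s) ^ 2 / 2 := by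
  have hanti : AntitoneOn (fun τ => y τ - (A * (τ - s) + c * (τ - s) ^ 2 / 2)) (Icc s t) := by
    have hd : ∀ τ ∈ Ioo s t, HasDerivAt (fun τ => y τ - (A * (τ - s) + c * (τ - s) ^ 2 / 2))
        (v τ - (A + c * (τ - s))) τ := fun τ hτ => by
      have h1 : HasDerivAt (fun τ => τ - s) 1 τ := (hasDerivAt_id τ).sub_const s
      refine ((h.hasDerivAt_y τ (hs.trans_lt hτ.1)).sub ((h1.const_mul A).add
        (((h1.pow 2).const_mul c).div_const 2))).congr_deriv ?_
      simp; ring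
    refine antitoneOn_of_deriv_nonpos (convex_Icc s t) ?_ ?_ ?_
    · refine (h.cont_y.mono fun τ hτ => hs.trans hτ.1).sub ?_
      fun_prop
    · rw [interior_Icc]
      exact fun τ hτ => (hd τ hτ).differentiableAt.differentiableWithinAt
    · rw [interior_Icc]
      intro τ hτ
      rw [(hd τ hτ).deriv]
      linarith [H τ hτ]
  have := hanti (left_mem_Icc.2 hst) (right_mem_Icc.2 hst) hst
  simp only [sub_self] at this
  nlinarith

theorem le_y_sub (h : IsSuboptimalTrajectory c₁ C₁ c₂ y v m) {s t A c : ℝ} (hs : 0 ≤ s)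
    (hst : s ≤ t) (H : ∀ τ ∈ Ioo s t, A + c * (τ - s) ≤ v τ) :
    A * (t - s) + c * (t - s) ^ 2 / 2 ≤ y t - y s := by
  have := h.neg.y_sub_le (A := -A) (c := -c) hs hst fun τ hτ => by linarith [H τ hτ]
  linarith

theorem exists_last_zero (h : IsSuboptimalTrajectory c₁ C₁ c₂ y v m) {a t : ℝ} (ha : 0 ≤ a)
    (hat : a ≤ t) (hz : a = 0 ∨ v a = 0) :
    ∃ z ∈ Icc a t, (z = 0 ∨ v z = 0) ∧ ∀ s ∈ Ioc z t, v s ≠ 0 := by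
  have hcl : IsClosed (Icc a t ∩ v ⁻¹' {0}) :=
    (h.cont_v.mono fun τ hτ => ha.trans hτ.1).preimage_isClosed_of_isClosed isClosed_Icc
      isClosed_singleton
  have hc : IsCompact (insert a (Icc a t ∩ v ⁻¹' {0})) :=
    (isCompact_Icc.of_isClosed_subset hcl inter_subset_left).insert a
  obtain ⟨z, hzmem, hzmax⟩ := hc.exists_isGreatest ⟨a, mem_insert _ _⟩
  have haz : a ≤ z := hzmax (mem_insert _ _)
  refine ⟨z, ?_, ?_, ?_⟩
  · rcases hzmem with rfl | hmem
    exacts [⟨le_rfl, hat⟩, hmem.1]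
  · rcases hzmem with rfl | hmem
    exacts [hz, Or.inr hmem.2]
  · intro s hs hvs
    exact absurd (hzmax (mem_insert_of_mem _ ⟨⟨haz.trans hs.1.le, hs.2⟩, hvs⟩)) (not_le.2 hs.1)

theorem exists_stored_eq (h : IsSuboptimalTrajectory c₁ C₁ c₂ y v m) {a t : ℝ} (ha : 0 ≤ a)
    (hat : a ≤ t) (hz : a = 0 ∨ v a = 0) : ∃ z ∈ Icc a t, m t = y z := by
  obtain ⟨z, hzm, hz0, hzs⟩ := h.exists_last_zero ha hat hz
  exact ⟨z, hzm, h.stored z t (ha.trans hzm.1) hzm.2 hz0 hzs⟩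

/-- As long as `y` varies by a factor of at most two after an extremum, it stays above half of the
stored value, so the law decelerates, whatever further zeros of the velocity there are. -/
theorem v_sub_le_of_close (h : IsSuboptimalTrajectory c₁ C₁ c₂ y v m) {a t Y : ℝ} (ha : 0 ≤ a)
    (hat : a ≤ t) (hz : v a = 0) (hy : ∀ τ ∈ Icc a t, Y < y τ ∧ y τ ≤ 2 * Y) :
    v t - v a ≤ -c₁ * (t - a) := by
  refine h.v_sub_le ha hat fun τ hτ α hα => ?_
  obtain ⟨z, hzm, hmz⟩ := h.exists_stored_eq ha hτ.1.le (Or.inr hz)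
  have h1 := hy z ⟨hzm.1, hzm.2.trans hτ.2.le⟩
  have h2 := hy τ ⟨hτ.1.le, hτ.2.le⟩
  exact (hα (by linarith)).1 (by linarith)

theorem exists_neg_right (h : IsSuboptimalTrajectory c₁ C₁ c₂ y v m) (hc₁ : 0 < c₁) {a : ℝ}
    (ha : 0 ≤ a) (hz : v a = 0) (hy : 0 < y a) : ∃ ε > 0, ∀ τ ∈ Ioc a (a + ε), v τ < 0 := by
  have hev : ∀ᶠ τ in nhdsWithin a (Ici 0), y τ ∈ Ioo (3 / 4 * y a) (5 / 4 * y a) :=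
    (h.cont_y a ha).eventually (Ioo_mem_nhds (by linarith) (by linarith))
  obtain ⟨ε, hε, hball⟩ := Metric.mem_nhdsWithin_iff.1 hev
  refine ⟨ε / 2, by positivity, fun τ hτ => ?_⟩
  have := h.v_sub_le_of_close (Y := 3 / 4 * y a) ha hτ.1.le hz fun s hs => by
    have := hball (show s ∈ Metric.ball a ε ∩ Ici 0 from
      ⟨by rw [Metric.mem_ball, Real.dist_eq, abs_lt]; constructor <;> linarith [hs.1, hs.2, hτ.2],
        ha.trans hs.1⟩)
    have h1 : y s ∈ Ioo (3 / 4 * y a) (5 / 4 * y a) := this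
    exact ⟨h1.1, by linarith [h1.2]⟩
  nlinarith [hτ.1]

/-- The velocity keeps its sign between zeros. -/
theorem v_neg_of_ne_zero (h : IsSuboptimalTrajectory c₁ C₁ c₂ y v m) {a t s : ℝ} (ha : 0 ≤ a)
    (hne : ∀ τ ∈ Ioo a t, v τ ≠ 0) (hs : s ∈ Ioo a t) (hvs : v s < 0) :
    ∀ τ ∈ Ioo a t, v τ < 0 := by
  intro τ hτ
  by_contra hcon
  have hcont : ContinuousOn v (uIcc s τ) := h.cont_v.mono fun r hr =>
    ha.trans (((ordConnected_Ioo.uIcc_subset hs hτ) hr).1.le)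
  have hmem : (0 : ℝ) ∈ uIcc (v s) (v τ) := by
    rw [mem_uIcc]; exact Or.inl ⟨hvs.le, not_lt.1 hcon⟩
  obtain ⟨r, hr, hr0⟩ := intermediate_value_uIcc hcont hmem
  exact hne r ((ordConnected_Ioo.uIcc_subset hs hτ) hr) hr0

/-! ### The half turn between two extremal values -/

/-- Contraction factor of the extremal values. -/
noncomputable def ratio (C₁ c₂ : ℝ) : ℝ := max (1 / 2) ((C₁ / c₂ - 1) / 2)

/-- Bound on the time between two successive extremal values, the first of them equal to `1`. -/
noncomputable def timeConst (c₁ C₁ c₂ : ℝ) : ℝ := √(1 / c₁) + √C₁ / c₂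

/-- The half turn that starts at a positive extremal value `y a`.  Until `y = y a / 2` the
deceleration is between `c₁` and `C₁`, so that half is reached in time `√(y a / c₁)` and with
kinetic energy at most `C₁ * (y a / 2)`.  From there on the velocity is lost at rate at least
`c₂`, within the distance `(C₁ / c₂) * (y a / 2)`. -/
theorem half_turn (h : IsSuboptimalTrajectory c₁ C₁ c₂ y v m) (hc₁ : 0 < c₁) (hC₁ : 0 < C₁)
    (hc₂ : 0 < c₂) {a t : ℝ} (ha : 0 ≤ a) (hat : a < t) (hz : v a = 0) (hya : 0 < y a)
    (hneg : ∀ τ ∈ Ioc a t, v τ < 0) :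
    t - a ≤ timeConst c₁ C₁ c₂ * √(y a) ∧ -(ratio C₁ c₂ * y a) ≤ y t := by
  have hstored : ∀ τ ∈ Ioc a t, m τ = y a := fun τ hτ =>
    h.stored a τ ha hτ.1.le (Or.inr hz) fun s hs => (hneg s ⟨hs.1, hs.2.trans hτ.2⟩).ne
  have hanti : ∀ r s, a ≤ r → r < s → s ≤ t → y s < y r := by
    intro r s har hrs hst
    have hd : StrictAntiOn y (Icc r s) := by
      refine strictAntiOn_of_deriv_neg (convex_Icc r s)
        (h.cont_y.mono fun τ hτ => (ha.trans har).trans hτ.1) ?_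
      rw [interior_Icc]
      intro τ hτ
      rw [(h.hasDerivAt_y τ (by linarith [hτ.1])).deriv]
      exact hneg τ ⟨by linarith [hτ.1], by linarith [hτ.2]⟩
    exact hd (left_mem_Icc.2 hrs.le) (right_mem_Icc.2 hrs.le) hrs
  -- first half: up to a time `c` with `y c ≥ y a / 2`
  have hfirst : ∀ c ∈ Icc a t, y a / 2 ≤ y c → c - a ≤ √(1 / c₁) * √(y a) := by
    intro c hc hyc
    have hv : ∀ τ ∈ Ioo a c, v τ ≤ 0 + -c₁ * (τ - a) := by
      intro τ hτ
      have := h.v_sub_le (c := -c₁) ha hτ.1.le fun s hs α hα => by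
        have hs1 := hanti s c hs.1.le (hs.2.trans hτ.2) hc.2
        rw [hstored s ⟨hs.1, by linarith [hs.2, hτ.2, hc.2]⟩] at hα
        exact (hα hya.le).1 (by linarith)
      linarith
    have hy1 := h.y_sub_le ha hc.1 hv
    rw [← Real.sqrt_mul (by positivity)]
    refine Real.le_sqrt_of_sq_le ?_
    rw [div_mul_eq_mul_div, one_mul, le_div_iff₀ hc₁]
    nlinarith
  have hsq : 0 ≤ √(y a) := Real.sqrt_nonneg _
  have hsC : 0 ≤ √C₁ / c₂ := by positivity
  rcases le_or_gt (y a / 2) (y t) with hyt | hyt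
  · refine ⟨?_, ?_⟩
    · have := hfirst t ⟨hat.le, le_rfl⟩ hyt
      rw [timeConst, add_mul]
      nlinarith [mul_nonneg hsC hsq]
    · have : 1 / 2 ≤ ratio C₁ c₂ := le_max_left _ _
      nlinarith
  · obtain ⟨c, hc, hyc⟩ : ∃ c ∈ Icc a t, y c = y a / 2 :=
      intermediate_value_Icc' hat.le (h.cont_y.mono fun τ hτ => ha.trans hτ.1)
        ⟨hyt.le, by linarith⟩
    have hac : a < c := lt_of_le_of_ne hc.1 (by rintro rfl; linarith)
    have hct : c < t := lt_of_le_of_ne hc.2 (by rintro rfl; linarith)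
    have hvc : v c < 0 := hneg c ⟨hac, hc.2⟩
    -- The kinetic energy at `c` is bounded without differentiating `v ^ 2`: the deceleration is at
    -- most `C₁`, so the speed was at least `-v c - C₁ * (c - τ)` at the times `τ` before `c`.
    have hvτ : ∀ τ ∈ Ico a c, -C₁ * (c - τ) ≤ v c - v τ := by
      intro τ hτ
      refine h.le_v_sub (ha.trans hτ.1) hτ.2.le fun s hs α hα => ?_
      have has : a < s := lt_of_le_of_lt hτ.1 hs.1
      rw [hstored s ⟨has, by linarith [hs.2]⟩] at hα
      have h1 := hanti s c has.le hs.2 hct.le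
      have h2 := hanti a s le_rfl has (by linarith [hs.2])
      exact (hα hya.le).2.1 (by linarith) (by linarith)
    have henergy : v c ^ 2 ≤ C₁ * y a := by
      set r := c - -v c / C₁ with hr
      have hmul : C₁ * (-v c / C₁) = -v c := by field_simp
      have hpos : 0 < -v c / C₁ := div_pos (by linarith) hC₁
      have har : a ≤ r := by
        have := hvτ a ⟨le_rfl, hac⟩
        rw [hz] at this
        have : -v c / C₁ ≤ c - a := by rw [div_le_iff₀ hC₁]; linarith
        linarith
      have h1 := h.y_sub_le (s := r) (t := c) (A := 0) (c := -C₁) (ha.trans har) (by linarith)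
        fun τ hτ => by
          have := hvτ τ ⟨har.trans hτ.1.le, hτ.2⟩
          have h3 : C₁ * r = C₁ * c + v c := by rw [hr, mul_sub, hmul]; ring
          nlinarith
      have h2 : y r ≤ y a := by
        rcases har.eq_or_lt with h' | h'
        · rw [← h']
        · exact (hanti a r le_rfl h' (by linarith)).le
      have h3 : c - r = -v c / C₁ := by rw [hr]; ring
      rw [h3] at h1
      have h4 : C₁ * (-v c / C₁) ^ 2 = v c ^ 2 / C₁ := by field_simp
      have h5 : v c ^ 2 / C₁ ≤ y a := by nlinarith
      rw [div_le_iff₀ hC₁] at h5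
      linarith
    -- second half: the deceleration of the motion is at least `c₂`
    have hv2 : ∀ τ ∈ Ioc c t, c₂ * (τ - c) ≤ v τ - v c := by
      intro τ hτ
      refine h.le_v_sub (ha.trans hac.le) hτ.1.le fun s hs α hα => ?_
      rw [hstored s ⟨hac.trans hs.1, by linarith [hs.2, hτ.2]⟩] at hα
      have h1 := hanti c s hac.le hs.1 (by linarith [hs.2, hτ.2])
      exact (hα hya.le).2.2 (by linarith)
    have htc : t - c ≤ √C₁ / c₂ * √(y a) := by
      have h1 := hv2 t ⟨hct, le_rfl⟩
      have h2 := hneg t ⟨hat, le_rfl⟩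
      have h3 : -v c ≤ √C₁ * √(y a) := by
        rw [← Real.sqrt_mul hC₁.le]
        exact Real.le_sqrt_of_sq_le (by linarith [henergy, neg_sq (v c)])
      rw [div_mul_eq_mul_div, le_div_iff₀ hc₂]
      linarith
    refine ⟨?_, ?_⟩
    · have := hfirst c hc hyc.ge
      rw [timeConst, add_mul]
      linarith
    · have h1 := h.le_y_sub (s := c) (t := t) (A := v c) (c := c₂) (ha.trans hac.le) hct.le
        fun τ hτ => by linarith [hv2 τ ⟨hτ.1, hτ.2.le⟩]
      have h2 : (C₁ / c₂ - 1) / 2 ≤ ratio C₁ c₂ := le_max_right _ _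
      have h3 : -(v c ^ 2 / c₂) / 2 ≤ v c * (t - c) + c₂ * (t - c) ^ 2 / 2 := by
        have h4 : v c * (t - c) + c₂ * (t - c) ^ 2 / 2 + (v c ^ 2 / c₂) / 2
            = (v c + c₂ * (t - c)) ^ 2 / c₂ / 2 := by field_simp; ring
        have h5 : 0 ≤ (v c + c₂ * (t - c)) ^ 2 / c₂ / 2 := by positivity
        linarith
      have h6 : v c ^ 2 / c₂ ≤ C₁ / c₂ * y a := by
        rw [div_mul_eq_mul_div]; gcongr
      nlinarith [mul_le_mul_of_nonneg_right h2 hya.le]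

theorem ratio_pos (C₁ c₂ : ℝ) : 0 < ratio C₁ c₂ := lt_of_lt_of_le (by norm_num) (le_max_left _ _)

theorem ratio_lt_one (hc₂ : 0 < c₂) (hC : C₁ < 3 * c₂) : ratio C₁ c₂ < 1 := by
  have : C₁ / c₂ < 3 := by rwa [div_lt_iff₀ hc₂]
  exact max_lt (by norm_num) (by linarith)

/-! ### Convergence of scalar trajectories in finite time -/

/-- Every positive extremal value is followed, within a time proportional to its square root, by
an extremal value that is smaller in modulus by the factor `ratio C₁ c₂`. -/
theorem exists_next_zero_of_pos (h : IsSuboptimalTrajectory c₁ C₁ c₂ y v m) (hc₁ : 0 < c₁)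
    (hC₁ : 0 < C₁) (hc₂ : 0 < c₂) {a : ℝ} (ha : 0 ≤ a) (hz : v a = 0) (hya : 0 < y a) :
    ∃ b, a ≤ b ∧ v b = 0 ∧ b - a ≤ timeConst c₁ C₁ c₂ * √(y a) ∧
      |y b| ≤ ratio C₁ c₂ * y a := by
  obtain ⟨ε, hε, hεneg⟩ := h.exists_neg_right hc₁ ha hz hya
  set K := timeConst c₁ C₁ c₂ * √(y a) with hK
  -- the velocity cannot stay negative up to `t₁`, as a half turn takes no longer than `K`
  set t₁ := a + max ε (K + 1) with ht₁
  have hεt₁ : a + ε ≤ t₁ := by have := le_max_left ε (K + 1); linarith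
  have hKt₁ : a + (K + 1) ≤ t₁ := by have := le_max_right ε (K + 1); linarith
  have hcl : IsClosed (Icc (a + ε) t₁ ∩ v ⁻¹' {0}) :=
    ContinuousOn.preimage_isClosed_of_isClosed
      (h.cont_v.mono fun τ hτ => by have := hτ.1; rw [mem_Ici]; linarith)
      isClosed_Icc isClosed_singleton
  have hne : (Icc (a + ε) t₁ ∩ v ⁻¹' {0}).Nonempty := by
    by_contra hcon
    have hnz : ∀ τ ∈ Ioo a t₁, v τ ≠ 0 := by
      intro τ hτ h0
      rcases le_or_gt τ (a + ε) with h1 | h1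
      · exact (hεneg τ ⟨hτ.1, h1⟩).ne h0
      · exact hcon ⟨τ, ⟨h1.le, hτ.2.le⟩, h0⟩
    have hneg' : ∀ τ ∈ Ioo a t₁, v τ < 0 :=
      h.v_neg_of_ne_zero ha hnz (s := a + ε / 2) ⟨by linarith, by linarith⟩
        (hεneg _ ⟨by linarith, by linarith⟩)
    have hK0 : 0 ≤ K := by rw [hK, timeConst]; positivity
    have := (h.half_turn (t := a + (K + 1 / 2)) hc₁ hC₁ hc₂ ha (by linarith) hz hya
      fun τ hτ => hneg' τ ⟨hτ.1, by linarith [hτ.2]⟩).1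
    linarith
  obtain ⟨b, hbmem, hbmin⟩ :=
    (isCompact_Icc.of_isClosed_subset hcl inter_subset_left).exists_isLeast hne
  have hab : a < b := by linarith [hbmem.1.1]
  have hneg : ∀ τ ∈ Ioo a b, v τ < 0 := by
    refine h.v_neg_of_ne_zero ha (fun τ hτ h0 => ?_) (s := a + ε / 2)
      ⟨by linarith, by linarith [hbmem.1.1]⟩ (hεneg _ ⟨by linarith, by linarith⟩)
    rcases le_or_gt τ (a + ε) with h1 | h1
    · exact (hεneg τ ⟨hτ.1, h1⟩).ne h0
    · exact absurd (hbmin ⟨⟨h1.le, hτ.2.le.trans hbmem.1.2⟩, h0⟩) (not_le.2 hτ.2)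
  have hturn : ∀ t ∈ Ioo a b, t - a ≤ K ∧ -(ratio C₁ c₂ * y a) ≤ y t := fun t ht =>
    h.half_turn hc₁ hC₁ hc₂ ha ht.1 hz hya fun τ hτ => hneg τ ⟨hτ.1, hτ.2.trans_lt ht.2⟩
  have hb0 : 0 < b := ha.trans_lt hab
  have hev : ∀ᶠ t in nhdsWithin b (Iio b), t ∈ Ioo a b := Ioo_mem_nhdsLT hab
  have htend : Filter.Tendsto y (nhdsWithin b (Iio b)) (nhds (y b)) :=
    (h.hasDerivAt_y b hb0).continuousAt.continuousWithinAt
  have hyb : -(ratio C₁ c₂ * y a) ≤ y b :=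
    ge_of_tendsto htend (hev.mono fun t ht => (hturn t ht).2)
  have htime : b - a ≤ K :=
    le_of_tendsto ((continuous_id.sub continuous_const).continuousWithinAt (x := b) (s := Iio b))
      (hev.mono fun t ht => (hturn t ht).1)
  refine ⟨b, hab.le, hbmem.2, htime, abs_le.2 ⟨hyb, ?_⟩⟩
  -- the trajectory passes `y a / 2`, as the velocity would not return to zero before
  suffices hhalf : y b ≤ y a / 2 by
    have : 1 / 2 ≤ ratio C₁ c₂ := le_max_left _ _
    nlinarith
  by_contra! hcon
  have hanti : StrictAntiOn y (Icc a b) := by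
    refine strictAntiOn_of_deriv_neg (convex_Icc a b)
      (h.cont_y.mono fun τ hτ => ha.trans hτ.1) ?_
    rw [interior_Icc]
    intro τ hτ
    rw [(h.hasDerivAt_y τ (by linarith [hτ.1])).deriv]
    exact hneg τ hτ
  have := h.v_sub_le (c := -c₁) ha hab.le fun τ hτ α hα => by
    rw [h.stored a τ ha hτ.1.le (Or.inr hz) fun s hs => (hneg s ⟨hs.1, hs.2.trans_lt hτ.2⟩).ne]
      at hα
    have := hanti ⟨hτ.1.le, hτ.2.le⟩ (right_mem_Icc.2 hab.le) hτ.2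
    exact (hα hya.le).1 (by linarith)
  have hvb : v b = 0 := hbmem.2
  rw [hz, hvb] at this
  nlinarith

theorem exists_next_zero (h : IsSuboptimalTrajectory c₁ C₁ c₂ y v m) (hc₁ : 0 < c₁)
    (hC₁ : 0 < C₁) (hc₂ : 0 < c₂) {a : ℝ} (ha : 0 ≤ a) (hz : v a = 0) :
    ∃ b, a ≤ b ∧ v b = 0 ∧ b - a ≤ timeConst c₁ C₁ c₂ * √|y a| ∧
      |y b| ≤ ratio C₁ c₂ * |y a| := by
  rcases lt_trichotomy (y a) 0 with hy | hy | hy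
  · obtain ⟨b, h1, h2, h3, h4⟩ :=
      h.neg.exists_next_zero_of_pos hc₁ hC₁ hc₂ ha (by simpa using hz) (neg_pos.2 hy)
    exact ⟨b, h1, by simpa using h2, by rwa [abs_of_neg hy], by
      rwa [abs_of_neg hy, ← abs_neg]⟩
  · exact ⟨a, le_rfl, hz, by simp [hy], by simp [hy]⟩
  · rw [abs_of_pos hy]
    exact h.exists_next_zero_of_pos hc₁ hC₁ hc₂ ha hz hy

/-- Until the next zero of the velocity, `y` stays below the modulus of the extremal value. -/
theorem lt_abs_of_ne_zero (h : IsSuboptimalTrajectory c₁ C₁ c₂ y v m) (hc₁ : 0 < c₁)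
    (hC₁ : 0 < C₁) (hc₂ : 0 < c₂) (hC : C₁ < 3 * c₂) {a p : ℝ} (ha : 0 ≤ a) (hap : a < p)
    (hz : v a = 0) (hne : ∀ τ ∈ Ioo a p, v τ ≠ 0) (hyp : 0 < y p) : y p < |y a| := by
  rcases lt_trichotomy (y a) 0 with hy | hy | hy
  · -- from a negative extremal value: contraction along the half turn of `-y`
    have hn := h.neg
    have hz' : -v a = 0 := by simpa using hz
    obtain ⟨ε, hε, hεneg⟩ := hn.exists_neg_right hc₁ ha hz' (neg_pos.2 hy)
    have hmin : 0 < min ε (p - a) := lt_min hε (by linarith)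
    have hneg := hn.v_neg_of_ne_zero ha (t := p) (fun τ hτ => by simpa using hne τ hτ)
      (s := a + min ε (p - a) / 2)
      ⟨by linarith, by linarith [min_le_right ε (p - a)]⟩
      (hεneg _ ⟨by linarith, by linarith [min_le_left ε (p - a)]⟩)
    have hturn : ∀ t ∈ Ioo a p, y t ≤ ratio C₁ c₂ * -y a := fun t ht => by
      have := (hn.half_turn hc₁ hC₁ hc₂ ha ht.1 hz' (neg_pos.2 hy)
        fun τ hτ => hneg τ ⟨hτ.1, hτ.2.trans_lt ht.2⟩).2
      linarith
    have hle : y p ≤ ratio C₁ c₂ * -y a :=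
      le_of_tendsto (h.hasDerivAt_y p (ha.trans_lt hap)).continuousAt.continuousWithinAt
        (Filter.Eventually.mono (Ioo_mem_nhdsLT hap) hturn)
    rw [abs_of_neg hy]
    nlinarith [ratio_lt_one hc₂ hC]
  · -- from the value zero: the velocity could only decrease while `y` is positive
    exfalso
    obtain ⟨s, hs, hds⟩ := exists_hasDerivAt_eq_slope y v hap
      (h.cont_y.mono fun τ hτ => ha.trans hτ.1) fun τ hτ => h.hasDerivAt_y τ (ha.trans_lt hτ.1)
    have hvs : 0 < v s := by
      rw [hds, hy]
      exact div_pos (by linarith) (by linarith)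
    have hpos : ∀ τ ∈ Ioo a p, 0 < v τ := fun τ hτ => by
      have := h.neg.v_neg_of_ne_zero ha (fun τ hτ => by simpa using hne τ hτ) hs
        (neg_lt_zero.2 hvs) τ hτ
      linarith
    have hmono : StrictMonoOn y (Icc a p) := by
      refine strictMonoOn_of_deriv_pos (convex_Icc a p)
        (h.cont_y.mono fun τ hτ => ha.trans hτ.1) ?_
      rw [interior_Icc]
      intro τ hτ
      rw [(h.hasDerivAt_y τ (by linarith [hτ.1])).deriv]
      exact hpos τ hτ
    have := h.v_sub_le (c := -c₁) ha hs.1.le fun τ hτ α hα => by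
      rw [h.stored a τ ha hτ.1.le (Or.inr hz)
        fun r hr => hne r ⟨hr.1, by linarith [hr.2, hτ.2, hs.2]⟩, hy] at hα
      have := hmono (left_mem_Icc.2 hap.le) ⟨hτ.1.le, by linarith [hτ.2, hs.2]⟩ hτ.1
      exact (hα le_rfl).1 (by linarith)
    rw [hz] at this
    nlinarith [hs.1]
  · obtain ⟨ε, hε, hεneg⟩ := h.exists_neg_right hc₁ ha hz hy
    have hmin : 0 < min ε (p - a) := lt_min hε (by linarith)
    have hneg := h.v_neg_of_ne_zero ha (t := p) hne (s := a + min ε (p - a) / 2)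
      ⟨by linarith, by linarith [min_le_right ε (p - a)]⟩
      (hεneg _ ⟨by linarith, by linarith [min_le_left ε (p - a)]⟩)
    have hanti : StrictAntiOn y (Icc a p) := by
      refine strictAntiOn_of_deriv_neg (convex_Icc a p)
        (h.cont_y.mono fun τ hτ => ha.trans hτ.1) ?_
      rw [interior_Icc]
      intro τ hτ
      rw [(h.hasDerivAt_y τ (by linarith [hτ.1])).deriv]
      exact hneg τ hτ
    rw [abs_of_pos hy]
    exact hanti (left_mem_Icc.2 hap.le) (right_mem_Icc.2 hap.le) hap

/-- A positive value of `y` is not the maximum of `|y|` on an interval that starts at rest at the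
origin: the zeros of the velocity cannot accumulate at the time of the maximum, since the law
decelerates there, and after the last one before it `|y|` only got smaller. -/
theorem not_isMax_of_rest (h : IsSuboptimalTrajectory c₁ C₁ c₂ y v m) (hc₁ : 0 < c₁)
    (hC₁ : 0 < C₁) (hc₂ : 0 < c₂) (hC : C₁ < 3 * c₂) {T p : ℝ} (hT : 0 ≤ T) (hTp : T ≤ p)
    (hyT : y T = 0) (hvT : v T = 0) (hyp : 0 < y p) : ¬ ∀ τ ∈ Icc T p, |y τ| ≤ y p := by
  intro hmax
  have hTp' : T < p := lt_of_le_of_ne hTp (by rintro rfl; linarith)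
  have hp0 : 0 < p := hT.trans_lt hTp'
  have hev : ∀ᶠ τ in nhdsWithin p (Iio p), τ ∈ Ioo T p := Ioo_mem_nhdsLT hTp'
  have hvp : 0 ≤ v p := by
    have hs := (h.hasDerivAt_y p hp0).hasDerivWithinAt (s := Iio p)
    rw [hasDerivWithinAt_iff_tendsto_slope' (by simp)] at hs
    refine ge_of_tendsto hs (hev.mono fun τ hτ => ?_)
    rw [slope_def_field]
    exact div_nonneg_of_nonpos
      (by have := (abs_le.1 (hmax τ ⟨hτ.1.le, hτ.2.le⟩)).2; linarith) (by linarith [hτ.2])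
  have hcont := (h.hasDerivAt_y p hp0).continuousAt
  have hhalf : ∀ᶠ τ in nhds p, y p / 2 < y τ := hcont.eventually (lt_mem_nhds (by linarith))
  obtain ⟨δ, hδ, hball⟩ := Metric.eventually_nhds_iff.1 hhalf
  set p' := max T (p - δ / 2) with hp'
  have hp'p : p' < p := max_lt hTp' (by linarith)
  have hp'T : T ≤ p' := le_max_left _ _
  have hlarge : ∀ τ ∈ Icc p' p, y p / 2 < y τ := fun τ hτ => hball (by
    rw [Real.dist_eq, abs_lt]
    have := le_max_right T (p - δ / 2)
    constructor <;> linarith [hτ.1, hτ.2])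
  have hnz : ∀ z ∈ Ico p' p, v z ≠ 0 := by
    intro z hz hvz
    have := h.v_sub_le_of_close (Y := y p / 2) (hT.trans (hp'T.trans hz.1)) hz.2.le hvz
      fun τ hτ => ⟨hlarge τ ⟨hz.1.trans hτ.1, hτ.2⟩, by
        have := (abs_le.1 (hmax τ ⟨(hp'T.trans hz.1).trans hτ.1, hτ.2⟩)).2
        linarith⟩
    rw [hvz] at this
    nlinarith [hz.2]
  obtain ⟨a, ham, haz, hane⟩ := h.exists_last_zero hT hp'T (Or.inr hvT)
  have hva : v a = 0 := by
    rcases haz with h0 | h0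
    · have : T = a := le_antisymm ham.1 (by linarith)
      rwa [← this]
    · exact h0
  have hap : a < p := ham.2.trans_lt hp'p
  have hlt := h.lt_abs_of_ne_zero hc₁ hC₁ hc₂ hC (hT.trans ham.1) hap hva (fun τ hτ => by
    rcases le_or_gt τ p' with h1 | h1
    · exact hane τ ⟨hτ.1, h1⟩
    · exact hnz τ ⟨h1.le, hτ.2⟩) hyp
  exact absurd (hmax a ⟨ham.1, hap.le⟩) (not_le.2 hlt)

/-- A trajectory at rest at the origin stays there. -/
theorem eq_zero_of_rest (h : IsSuboptimalTrajectory c₁ C₁ c₂ y v m) (hc₁ : 0 < c₁)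
    (hC₁ : 0 < C₁) (hc₂ : 0 < c₂) (hC : C₁ < 3 * c₂) {T : ℝ} (hT : 0 ≤ T)
    (hyT : y T = 0) (hvT : v T = 0) : ∀ t, T ≤ t → y t = 0 ∧ v t = 0 := by
  have hy : ∀ t, T ≤ t → y t = 0 := by
    intro t ht
    obtain ⟨p, hp, hmax⟩ := isCompact_Icc.exists_isMaxOn (nonempty_Icc.2 ht)
      ((h.cont_y.mono fun τ hτ => hT.trans hτ.1).abs (s := Icc T t))
    have hmax' : ∀ τ ∈ Icc T t, |y τ| ≤ |y p| := fun τ hτ => hmax hτ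
    rcases lt_trichotomy (y p) 0 with h0 | h0 | h0
    · refine absurd (fun τ hτ => ?_) (h.neg.not_isMax_of_rest hc₁ hC₁ hc₂ hC hT hp.1
        (by simpa using hyT) (by simpa using hvT) (neg_pos.2 h0))
      rw [abs_neg, ← abs_of_neg h0]
      exact hmax' τ ⟨hτ.1, hτ.2.trans hp.2⟩
    · have := hmax' t (right_mem_Icc.2 ht)
      rw [h0, abs_zero] at this
      exact abs_nonpos_iff.1 this
    · refine absurd (fun τ hτ => ?_)
        (h.not_isMax_of_rest hc₁ hC₁ hc₂ hC hT hp.1 hyT hvT h0)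
      rw [← abs_of_pos h0]
      exact hmax' τ ⟨hτ.1, hτ.2.trans hp.2⟩
  intro t ht
  refine ⟨hy t ht, ?_⟩
  rcases ht.eq_or_lt with rfl | hlt
  · exact hvT
  · have h1 : y =ᶠ[nhds t] fun _ => 0 :=
      Filter.mem_of_superset (Ioi_mem_nhds hlt) fun s hs => hy s (le_of_lt hs)
    exact (h.hasDerivAt_y t (hT.trans_lt hlt)).unique
      ((hasDerivAt_const t (0 : ℝ)).congr_of_eventuallyEq h1)

/-- The initial phase, when the stored value `y 0` is not yet an extremal value: the law drives the
velocity to zero, if necessary after `y` has crossed `y 0 / 2`. -/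
theorem exists_first_zero_of_nonneg (h : IsSuboptimalTrajectory c₁ C₁ c₂ y v m) (hc₁ : 0 < c₁)
    (hc₂ : 0 < c₂) (hy0 : 0 ≤ y 0) : ∃ a, 0 ≤ a ∧ v a = 0 := by
  by_contra! hne
  have hstored : ∀ t, 0 ≤ t → m t = y 0 := fun t ht =>
    h.stored 0 t le_rfl ht (Or.inl rfl) fun s hs => hne s hs.1.le
  have hsign : ∀ t, 0 ≤ t → 0 < v 0 * v t := by
    intro t ht
    by_contra! hcon
    have hcont : ContinuousOn (fun s => v 0 * v s) (Icc 0 t) :=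
      continuousOn_const.mul (h.cont_v.mono fun τ hτ => hτ.1)
    obtain ⟨r, hr, hr0⟩ := intermediate_value_Icc' ht hcont ⟨hcon, mul_self_nonneg (v 0)⟩
    exact (mul_ne_zero (hne 0 le_rfl) (hne r hr.1)) hr0
  rcases lt_or_gt_of_ne (hne 0 le_rfl) with hv0 | hv0
  · have hneg : ∀ t, 0 ≤ t → v t < 0 := fun t ht => by nlinarith [hsign t ht]
    have hanti : StrictAntiOn y (Ici 0) := by
      refine strictAntiOn_of_deriv_neg (convex_Ici 0) h.cont_y ?_
      rw [interior_Ici]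
      intro τ hτ
      rw [(h.hasDerivAt_y τ hτ).deriv]
      exact hneg τ (le_of_lt hτ)
    by_cases hcross : ∃ s, 0 ≤ s ∧ y s < y 0 / 2
    · obtain ⟨s, hs, hys⟩ := hcross
      have hvs := hneg s hs
      have hpos : 0 < -v s / c₂ := div_pos (by linarith) hc₂
      have h1 := h.le_v_sub (s := s) (t := s + -v s / c₂) (c := c₂) hs (by linarith)
        fun τ hτ α hα => by
          rw [hstored τ (hs.trans hτ.1.le)] at hα
          have := hanti hs (hs.trans hτ.1.le) hτ.1
          exact (hα hy0).2.2 (by linarith)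
      have h2 : c₂ * (s + -v s / c₂ - s) = -v s := by field_simp; ring
      have h3 := hneg (s + -v s / c₂) (by linarith)
      linarith
    · push Not at hcross
      have hvle : ∀ t, 0 ≤ t → v t ≤ v 0 := fun t ht => by
        have := h.v_sub_le (c := -c₁) le_rfl ht fun τ hτ α hα => by
          rw [hstored τ hτ.1.le] at hα
          have h1 := hcross t ht
          have h2 := hanti (mem_Ici.2 hτ.1.le) (mem_Ici.2 ht) hτ.2
          exact (hα hy0).1 (by linarith)
        nlinarith
      have hpos : 0 ≤ y 0 / -v 0 := div_nonneg hy0 (by linarith)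
      have h1 := h.y_sub_le (s := 0) (t := y 0 / -v 0 + 1) (A := v 0) (c := 0) le_rfl
        (by linarith) fun τ hτ => by linarith [hvle τ hτ.1.le]
      have h2 := hcross (y 0 / -v 0 + 1) (by linarith)
      have h3 : v 0 * (y 0 / -v 0) = -y 0 := by
        rw [div_neg, mul_neg, mul_div_cancel₀ _ hv0.ne]
      nlinarith
  · have hpos : ∀ t, 0 ≤ t → 0 < v t := fun t ht => pos_of_mul_pos_right (hsign t ht) hv0.le
    have hmono : StrictMonoOn y (Ici 0) := by
      refine strictMonoOn_of_deriv_pos (convex_Ici 0) h.cont_y ?_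
      rw [interior_Ici]
      intro τ hτ
      rw [(h.hasDerivAt_y τ hτ).deriv]
      exact hpos τ (le_of_lt hτ)
    have hq : 0 < v 0 / c₁ := div_pos hv0 hc₁
    have h1 := h.v_sub_le (s := 0) (t := v 0 / c₁) (c := -c₁) le_rfl hq.le fun τ hτ α hα => by
      rw [hstored τ hτ.1.le] at hα
      have := hmono (mem_Ici.2 le_rfl) (mem_Ici.2 hτ.1.le) hτ.1
      exact (hα hy0).1 (by linarith)
    have h2 : -c₁ * (v 0 / c₁ - 0) = -v 0 := by field_simp; ring
    have h3 := hpos (v 0 / c₁) hq.le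
    linarith

theorem exists_first_zero (h : IsSuboptimalTrajectory c₁ C₁ c₂ y v m) (hc₁ : 0 < c₁)
    (hc₂ : 0 < c₂) : ∃ a, 0 ≤ a ∧ v a = 0 := by
  rcases le_total 0 (y 0) with hy | hy
  · exact h.exists_first_zero_of_nonneg hc₁ hc₂ hy
  · simpa using h.neg.exists_first_zero_of_nonneg hc₁ hc₂ (neg_nonneg.2 hy)

/-- **Finite-time convergence.**  The times of the successive extremal values have geometrically
decreasing distances, so they converge; at their limit the trajectory is at rest at the origin. -/
theorem exists_time_forall_eq_zero (h : IsSuboptimalTrajectory c₁ C₁ c₂ y v m) (hc₁ : 0 < c₁)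
    (hC₁ : 0 < C₁) (hc₂ : 0 < c₂) (hC : C₁ < 3 * c₂) :
    ∃ T, 0 ≤ T ∧ ∀ t, T ≤ t → y t = 0 ∧ v t = 0 := by
  obtain ⟨a₀, ha₀, hva₀⟩ := h.exists_first_zero hc₁ hc₂
  have hnext : ∀ a : {a : ℝ // 0 ≤ a ∧ v a = 0}, ∃ b : {a : ℝ // 0 ≤ a ∧ v a = 0},
      a.1 ≤ b.1 ∧ b.1 - a.1 ≤ timeConst c₁ C₁ c₂ * √|y a.1| ∧
        |y b.1| ≤ ratio C₁ c₂ * |y a.1| := fun a => by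
    obtain ⟨b, h1, h2, h3, h4⟩ := h.exists_next_zero hc₁ hC₁ hc₂ a.2.1 a.2.2
    exact ⟨⟨b, a.2.1.trans h1, h2⟩, h1, h3, h4⟩
  choose next hle htime hcontr using hnext
  let z : ℕ → {a : ℝ // 0 ≤ a ∧ v a = 0} := fun k => next^[k] ⟨a₀, ha₀, hva₀⟩
  have hz : ∀ k, z (k + 1) = next (z k) := fun k => Function.iterate_succ_apply' _ _ _
  set q := ratio C₁ c₂ with hq
  have hq0 : 0 < q := ratio_pos _ _
  have hq1 : q < 1 := ratio_lt_one hc₂ hC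
  have hK : 0 ≤ timeConst c₁ C₁ c₂ := by rw [timeConst]; positivity
  have hyz : ∀ k, |y (z k).1| ≤ q ^ k * |y a₀| := by
    intro k
    induction k with
    | zero => simp [z]
    | succ k ih =>
      rw [hz, pow_succ']
      refine (hcontr (z k)).trans ?_
      rw [mul_assoc]
      gcongr
  have hdist : ∀ k, dist (z k).1 (z (k + 1)).1 ≤
      timeConst c₁ C₁ c₂ * √|y a₀| * √q ^ k := by
    intro k
    rw [hz, dist_comm, Real.dist_eq, abs_of_nonneg (sub_nonneg.2 (hle _))]
    refine (htime (z k)).trans ?_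
    rw [mul_assoc]
    gcongr
    refine (Real.sqrt_le_sqrt (hyz k)).trans (le_of_eq ?_)
    rw [Real.sqrt_mul (by positivity), mul_comm]
    congr 1
    rw [Real.sqrt_eq_iff_mul_self_eq (by positivity) (by positivity), ← mul_pow,
      Real.mul_self_sqrt hq0.le]
  have hsq1 : √q < 1 := by rw [Real.sqrt_lt' one_pos]; simpa using hq1
  obtain ⟨T, hT⟩ := cauchySeq_tendsto_of_complete (cauchySeq_of_le_geometric _ _ hsq1 hdist)
  have hT0 : 0 ≤ T := ge_of_tendsto' hT fun k => (z k).2.1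
  have hTw : Filter.Tendsto (fun k => (z k).1) Filter.atTop (nhdsWithin T (Ici 0)) :=
    tendsto_nhdsWithin_iff.2 ⟨hT, Filter.Eventually.of_forall fun k => (z k).2.1⟩
  have hvT : v T = 0 := by
    refine tendsto_nhds_unique ((h.cont_v T hT0).tendsto.comp hTw) ?_
    simp only [Function.comp_def, (z _).2.2]
    exact tendsto_const_nhds
  have hyT : y T = 0 := by
    refine tendsto_nhds_unique ((h.cont_y T hT0).tendsto.comp hTw) ?_
    refine squeeze_zero_norm (a := fun k => q ^ k * |y a₀|) hyz ?_
    simpa using (tendsto_pow_atTop_nhds_zero_of_lt_one hq0.le hq1).mul_const |y a₀|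
  exact ⟨T, hT0, h.eq_zero_of_rest hc₁ hC₁ hc₂ hC hT0 hyT hvT⟩

end IsSuboptimalTrajectory

/-! ### The sliding function of a closed-loop solution -/

theorem lastExtremalValue_eq {ξ v : ℝ → ℝ} (hd : ∀ t, 0 < t → HasDerivAt ξ (v t) t) {a t : ℝ}
    (ha : 0 ≤ a) (hat : a ≤ t) (hz : a = 0 ∨ v a = 0) (hne : ∀ s ∈ Ioc a t, v s ≠ 0) :
    lastExtremalValue ξ t = ξ a := by
  have : IsGreatest {τ | τ ∈ Icc 0 t ∧ (τ = 0 ∨ deriv ξ τ = 0)} a := by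
    refine ⟨⟨⟨ha, hat⟩, ?_⟩, fun τ hτ => ?_⟩
    · rcases ha.eq_or_lt with h0 | h0
      · exact Or.inl h0.symm
      · exact Or.inr ((hd a h0).deriv.trans (hz.resolve_left h0.ne'))
    · by_contra! hlt
      have hτ0 : 0 < τ := ha.trans_lt hlt
      exact hne τ ⟨hlt, hτ.1.2⟩ ((hd τ hτ0).deriv.symm.trans (hτ.2.resolve_left hτ0.ne'))
  rw [lastExtremalValue, this.csSup_eq]

/-- Bounds on `σ̈ = φ + G w` for a Filippov value `w` of the law. -/
theorem accelBound_of_mem_filippov {αs W m y φ Φ G w : ℝ} (hα : αs ≤ 1) (hW : 0 ≤ W)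
    (hG : 0 ≤ G) (hφ : |φ| ≤ Φ) (hw : w ∈ filippov (ssosmLaw αs W m) y) :
    AccelBound (αs * W * G - Φ) (αs * W * G + Φ) (W * G - Φ) m y (φ + G * w) := by
  obtain ⟨h1, h2⟩ := abs_le.1 hφ
  refine fun hm => ⟨fun hy => ?_, fun hy hym => ?_, fun hy => ?_⟩
  · have := mul_le_mul_of_nonneg_left (filippov_ssosmLaw_of_half_lt hα hW hy hw).2 hG
    linarith
  · have := mul_le_mul_of_nonneg_left (filippov_ssosmLaw_of_half_lt_of_lt hy hym hw).1 hG
    linarith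
  · have := mul_le_mul_of_nonneg_left (filippov_ssosmLaw_of_lt_half hm hy hw).1 hG
    linarith

section ClosedLoop

variable {ι E : Type*} [Fintype ι] [DecidableEq ι] [Fintype E] {N : PowerNetwork ι E}
  {C : ControlDesign ι} {αs W : ι → ℝ} {Pd : ℝ → ι → ℝ} {x : ℝ → PowerState ι E}

namespace IsClosedLoopSolution

theorem ac_slidingFn (hx : IsClosedLoopSolution N C αs W Pd x) (i : ι) :
    LocallyACOnNonneg fun t => slidingFn C (x t) i :=
  ((((hx.ac_f i).const_mul _).add ((hx.ac_Pt i).const_mul _)).add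
    ((hx.ac_Pg i).const_mul _)).add ((hx.ac_θ i).const_mul _)

theorem ac_slidingFnDot (hx : IsClosedLoopSolution N C αs W Pd x)
    (hPd : ∀ i, LocallyACOnNonneg fun t => Pd t i) (i : ι) :
    LocallyACOnNonneg fun t => slidingFnDot N C (x t) (Pd t) i := by
  have hflow : ∀ k, LocallyACOnNonneg fun t => N.Γ (x t).V k * Real.sin ((x t).η k) := fun k =>
    (((hx.ac_V _).mul (hx.ac_V _)).mul (.const _)).mul (hx.ac_η k).sin
  have hf : LocallyACOnNonneg fun t => fDot N (x t) (Pd t) i :=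
    ((hx.ac_f i).neg.add ((((hx.ac_Pt i).sub (hPd i)).sub
      (.mulVec N.incidence hflow i)).const_mul _)).const_mul _
  have hPt : LocallyACOnNonneg fun t => PtDot N (x t) i :=
    ((hx.ac_Pt i).neg.add (hx.ac_Pg i)).const_mul _
  have hPg : LocallyACOnNonneg fun t => PgDot N (x t) i :=
    ((((hx.ac_f i).const_mul _).sub (hx.ac_Pg i)).add (hx.ac_u i)).const_mul _
  have hθ : LocallyACOnNonneg fun t => θDot C (x t) i :=
    (((hx.ac_θ i).neg.add (hx.ac_Pt i)).sub ((LocallyACOnNonneg.mulVec C.lap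
      (fun j => ((hx.ac_θ j).const_mul _).add (.const _)) i).const_mul _)).const_mul _
  exact (((hf.const_mul _).add (hPt.const_mul _)).add (hPg.const_mul _)).add (hθ.const_mul _)

theorem hasDerivAt_slidingFn (hx : IsClosedLoopSolution N C αs W Pd x)
    (hPd : ∀ i, LocallyACOnNonneg fun t => Pd t i) (i : ι) {t : ℝ} (ht : 0 < t) :
    HasDerivAt (fun s => slidingFn C (x s) i) (slidingFnDot N C (x t) (Pd t) i) t := by
  refine (hx.ac_slidingFn i).hasDerivAt_of_ae (hx.ac_slidingFnDot hPd i).continuousOn ?_ ht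
  filter_upwards [hx.ode_f i, hx.ode_Pt i, hx.ode_Pg i, hx.ode_θ i] with s hf hPt hPg hθ
  exact (((hf.const_mul _).add (hPt.const_mul _)).add (hPg.const_mul _)).add (hθ.const_mul _)

/-- In every area, the sliding function along a closed-loop solution is a trajectory of the scalar
problem, by the auxiliary system `σ̈ = φ + G w`. -/
theorem isSuboptimalTrajectory (hx : IsClosedLoopSolution N C αs W Pd x)
    (hPd : ∀ i, LocallyACOnNonneg fun t => Pd t i) (i : ι) {Φ : ℝ} (hα : αs i ≤ 1)
    (hW : 0 ≤ W i) (hG : 0 ≤ gainG N C i)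
    (hφ : ∀ᵐ t ∂volume.restrict (Ioi (0 : ℝ)),
      |driftφ N C (x t) (Pd t) (fun j => deriv (fun s => Pd s j) t) i| ≤ Φ) :
    IsSuboptimalTrajectory (αs i * W i * gainG N C i - Φ) (αs i * W i * gainG N C i + Φ)
      (W i * gainG N C i - Φ) (fun t => slidingFn C (x t) i)
      (fun t => slidingFnDot N C (x t) (Pd t) i)
      (lastExtremalValue fun s => slidingFn C (x s) i) where
  ac_v := hx.ac_slidingFnDot hPd i
  cont_y := (hx.ac_slidingFn i).continuousOn
  hasDerivAt_y t ht := hx.hasDerivAt_slidingFn hPd i ht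
  stored a t ha hat hz hne :=
    lastExtremalValue_eq (fun s hs => hx.hasDerivAt_slidingFn hPd i hs) ha hat hz hne
  accel := by
    filter_upwards [ae_all_iff.2 hx.ode_η, ae_all_iff.2 hx.ode_f, ae_all_iff.2 hx.ode_V,
      ae_all_iff.2 hx.ode_Pt, ae_all_iff.2 hx.ode_Pg, ae_all_iff.2 hx.ode_θ,
      ae_all_iff.2 hx.ode_u, ae_all_iff.2 fun j => (hPd j).ae_differentiableAt, hφ]
      with t hη hf hV hPt hPg hθ hu hd hφt
    choose w hw hwd using hu
    rw [(hasDerivAt_slidingFnDot N C x Pd _ w t hη hf hV hPt hPg hθ hwd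
      (fun j => (hd j).hasDerivAt) i).deriv]
    refine ⟨accelBound_of_mem_filippov hα hW hG hφt (hw i), ?_⟩
    rw [neg_add, ← mul_neg]
    exact accelBound_of_mem_filippov hα hW hG (by rwa [abs_neg])
      (neg_mem_filippov (ssosmLaw_neg _ _ _) (hw i))

end IsClosedLoopSolution

end ClosedLoop

/-- On `σ = 0` the generated power is determined by the other states. -/
theorem Pg_eq_of_slidingFn_eq_zero {ι E : Type*} [Fintype ι] [DecidableEq ι]
    (C : ControlDesign ι) {x : PowerState ι E} (hσ : slidingFn C x = 0) :
    x.Pg = -(Matrix.diagonal C.M₃)⁻¹.mulVec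
        ((Matrix.diagonal C.M₁).mulVec x.f + (Matrix.diagonal C.M₂).mulVec x.Pt
          + (Matrix.diagonal C.M₄).mulVec x.θ) := by
  have hinv : (Matrix.diagonal C.M₃)⁻¹ = Matrix.diagonal fun i => (C.M₃ i)⁻¹ := by
    refine Matrix.inv_eq_right_inv ?_
    rw [Matrix.diagonal_mul_diagonal, ← Matrix.diagonal_one]
    exact congrArg _ (funext fun i => mul_inv_cancel₀ (C.M₃_pos i).ne')
  funext i
  have hi : C.M₁ i * x.f i + C.M₂ i * x.Pt i + C.M₃ i * x.Pg i + C.M₄ i * x.θ i = 0 :=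
    congrFun hσ i
  have h3 := (C.M₃_pos i).ne'
  simp only [hinv, Pi.neg_apply, Matrix.mulVec_diagonal, Pi.add_apply]
  field_simp
  linarith

theorem lemma5 {ι E : Type*} [Fintype ι] [DecidableEq ι] [Fintype E]
    (N : PowerNetwork ι E) (C : ControlDesign ι)
    -- unknown bounded demand
    (Pd : ℝ → ι → ℝ) (D : ι → ℝ)
    (hD : ∀ i, 0 < D i)
    (hPd : ∀ i, ∀ t, 0 ≤ t → |Pd t i| ≤ D i)
    (hPdAC : ∀ i, LocallyACOnNonneg fun t => Pd t i)
    -- known bounds and controller parameters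
    (Φ Gmin Gmax αs W : ι → ℝ)
    (hΦ : ∀ i, 0 < Φ i)
    (hGmin : ∀ i, 0 < Gmin i)
    (hG : ∀ i, gainG N C i ∈ Set.Icc (Gmin i) (Gmax i))
    (hαs : ∀ i, αs i ∈ Set.Ioc 0 1 ∩ Set.Ioo 0 (3 * Gmin i / Gmax i))
    (hW : ∀ i, max (Φ i / (αs i * Gmin i)) (4 * Φ i / (3 * Gmin i - αs i * Gmax i)) < W i)
    -- a closed-loop solution along which the bound on `φ` holds
    (x : ℝ → PowerState ι E)
    (hx : IsClosedLoopSolution N C αs W Pd x)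
    (hφ : ∀ i, ∀ᵐ t ∂MeasureTheory.volume.restrict (Set.Ioi (0 : ℝ)),
      |driftφ N C (x t) (Pd t) (fun j => deriv (fun s => Pd s j) t) i| ≤ Φ i) :
    ∃ Tr : ℝ, 0 ≤ Tr ∧ ∀ t, Tr ≤ t →
      x t ∈ slidingManifold N C (Pd t) ∧
      (x t).Pg = -(Matrix.diagonal C.M₃)⁻¹.mulVec
        ((Matrix.diagonal C.M₁).mulVec (x t).f + (Matrix.diagonal C.M₂).mulVec (x t).Pt
          + (Matrix.diagonal C.M₄).mulVec (x t).θ) := by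
  have hT : ∀ i, ∃ T, 0 ≤ T ∧ ∀ t, T ≤ t →
      slidingFn C (x t) i = 0 ∧ slidingFnDot N C (x t) (Pd t) i = 0 := by
    intro i
    obtain ⟨⟨hα0, hα1⟩, -, hα2⟩ := hαs i
    obtain ⟨hGl, hGu⟩ := hG i
    have hG0 : 0 < gainG N C i := (hGmin i).trans_le hGl
    rw [lt_div_iff₀ (hG0.trans_le hGu)] at hα2
    obtain ⟨hW1, hW2⟩ := max_lt_iff.1 (hW i)
    rw [div_lt_iff₀ (mul_pos hα0 (hGmin i))] at hW1
    rw [div_lt_iff₀ (by linarith)] at hW2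
    have hW0 : 0 < W i := pos_of_mul_pos_left ((hΦ i).trans hW1) (mul_pos hα0 (hGmin i)).le
    have hαW : 0 < αs i * W i := mul_pos hα0 hW0
    have h1 : αs i * W i * Gmin i ≤ αs i * W i * gainG N C i := by gcongr
    have h2 : αs i * W i * gainG N C i ≤ W i * gainG N C i :=
      mul_le_mul_of_nonneg_right (mul_le_of_le_one_left hW0.le hα1) hG0.le
    have h3 : W i * Gmin i ≤ W i * gainG N C i := by gcongr
    have h4 : αs i * W i * gainG N C i ≤ αs i * W i * Gmax i := by gcongr
    have hΦi := hΦ i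
    exact (hx.isSuboptimalTrajectory hPdAC i hα1 hW0.le hG0.le (hφ i)).exists_time_forall_eq_zero
      (by linarith) (by linarith) (by linarith) (by linarith)
  choose T hT0 hT using hT
  refine ⟨∑ i, T i, Finset.sum_nonneg fun i _ => hT0 i, fun t ht => ?_⟩
  have hTt : ∀ i, T i ≤ t := fun i =>
    (Finset.single_le_sum (fun j _ => hT0 j) (Finset.mem_univ i)).trans ht
  have hσ : slidingFn C (x t) = 0 := funext fun i => (hT i t (hTt i)).1
  exact ⟨⟨hσ, funext fun i => (hT i t (hTt i)).2⟩, Pg_eq_of_slidingFn_eq_zero C hσ⟩
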